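/- Let $(S,d)$ be a locally compact, separable, unbounded metric space, and write $B(x,r)=\{y\in S: d(x,y)<r\}$. Suppose that $S$ is doubling (there is $N\in\mathbb{N}$ such that every ball $B(x,r)$, $r>0$, can be covered by at most $N$ balls of radius $r/2$) and uniformly perfect (there is $\sigma>1$ such that $B(x,\sigma r)\setminus B(x,r)\neq\emptyset$ for all $x\in S$ and $r>0$). Let $\mu$ be a Borel measure on $S$ with $\mu(S)=\infty$ that is finite on bounded Borel sets, and suppose that there are $C_V\ge 1$ and $s>0$ with $\mu(B(x,r))\le C_V r^s$ for all $x\in S$ and $r>0$. Let $R_0>0$ and let $\rho=\delta_{R_0}$ be the unit point mass at $R_0$ on $(0,\infty)$. For $\lambda>0$ let $\xi_\lambda$ be a Poisson point process on $S\times(0,\infty)$ with intensity measure $(\lambda\mu)\otimes\rho$, that is, a random counting measure such that $\xi_\lambda(A)$ is Poisson distributed with parameter $((\lambda\mu)\otimes\rho)(A)$ for every Borel set $A$ (with $\xi_\lambda(A)=\infty$ almost surely if the parameter is $\infty$) and $\xi_\lambda(A_1),\dots,\xi_\lambda(A_n)$ are independent for disjoint Borel sets $A_1,\dots,A_n$.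 Let $\mathbb{P}_\lambda$ denote its distribution. For $x,y\in S$ write $x\leftrightarrow y$ if there is a finite sequence $(z_0,R_0'),\dots,(z_n,R_n')$ in $\operatorname{supp}\xi_\lambda$ with $x\in B(z_0,R_0')$, $y\in B(z_n,R_n')$ and $B(z_{i-1},R_{i-1}')\cap B(z_i,R_i')\neq\emptyset$ for $i=1,\dots,n$, and set $M(x)=\sup\{d(x,y): y\in S,\ x\leftrightarrow y\}\in[0,\infty]$, with $\sup\emptyset=0$. Then there exists $\lambda_0>0$ such that for all $\lambda\in(0,\lambda_0)$, $$\lim_{r\to\infty}\ \sup_{x\in S}\ \mathbb{P}_\lambda\bigl(M(x)>r\bigr)=0.$$ -/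

import Mathlib

open MeasureTheory ProbabilityTheory Filter Topology
open scoped ENNReal NNReal

namespace BooleanPercolation

section MetricNotions

variable (S : Type*) [MetricSpace S]

/-- `S` is (metric) doubling: for some `N`, every ball can be covered by at most `N` balls of
half its radius. -/
def IsDoubling : Prop :=
  ∃ N : ℕ, ∀ (x : S) (r : ℝ), 0 < r →
    ∃ t : Finset S, t.card ≤ N ∧ Metric.ball x r ⊆ ⋃ y ∈ t, Metric.ball y (r / 2)

/-- `S` is uniformly perfect: for some `σ > 1`, the annulus `B(x, σ r) \ B(x, r)` is nonempty for
all `x` and all `r > 0`. -/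
def IsUniformlyPerfect : Prop :=
  ∃ σ : ℝ, 1 < σ ∧ ∀ (x : S) (r : ℝ), 0 < r →
    (Metric.ball x (σ * r) \ Metric.ball x r).Nonempty

variable {S}

/-- `μ` is finite on bounded Borel sets. -/
def IsBoundedlyFinite [MeasurableSpace S] (μ : Measure S) : Prop :=
  ∀ A : Set S, MeasurableSet A → Bornology.IsBounded A → μ A < ∞

end MetricNotions

section PointProcess

variable {X Ω : Type*} [MeasurableSpace X] [MeasurableSpace Ω]

/-- `ν` is a counting measure: a countable sum of unit point masses (repetitions allowed). -/
def IsCountingMeasure (ν : Measure X) : Prop :=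
  ∃ (I : Set ℕ) (p : I → X), ν = Measure.sum fun i => Measure.dirac (p i)

/-- The Poisson distribution with parameter `a ∈ [0, ∞]`, as a law on `[0, ∞]`; with parameter `∞`
it is the unit mass at `∞`. -/
noncomputable def poissonLaw (a : ℝ≥0∞) : Measure ℝ≥0∞ :=
  if a = ∞ then Measure.dirac ∞
  else (poissonMeasure a.toNNReal).map (fun n : ℕ => (n : ℝ≥0∞))

/-- Under `P`, the random counting measure `ξ` is a Poisson point process with intensity measure
`m`. -/
structure IsPoissonPointProcess (ξ : Ω → Measure X) (m : Measure X) (P : Measure Ω) : Prop where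
  measurable : Measurable ξ
  counting : ∀ ω, IsCountingMeasure (ξ ω)
  poisson : ∀ A : Set X, MeasurableSet A → P.map (fun ω => ξ ω A) = poissonLaw (m A)
  indep : ∀ (n : ℕ) (A : Fin n → Set X), (∀ i, MeasurableSet (A i)) →
    Pairwise (fun i j => Disjoint (A i) (A j)) → iIndepFun (fun i ω => ξ ω (A i)) P

end PointProcess

section Percolation

variable {S : Type*} [MetricSpace S]

/-- The ball `B(x, R)` encoded by a marked point `(x, R) ∈ S × (0, ∞)`. -/
def markedBall (p : S × Set.Ioi (0 : ℝ)) : Set S := Metric.ball p.1 p.2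

variable [MeasurableSpace S]

/-- `(p 0, …, p n)` is a percolative chain of the configuration `ν`: its members lie in the support
of `ν` and consecutive balls intersect. -/
def IsPercolativeChain (ν : Measure (S × Set.Ioi (0 : ℝ))) (n : ℕ)
    (p : Fin (n + 1) → S × Set.Ioi (0 : ℝ)) : Prop :=
  (∀ i, p i ∈ ν.support) ∧
    ∀ i : Fin n, (markedBall (p i.castSucc) ∩ markedBall (p i.succ)).Nonempty

/-- `x ↔ y` in the configuration `ν`. -/
def Percolates (ν : Measure (S × Set.Ioi (0 : ℝ))) (x y : S) : Prop :=
  ∃ (n : ℕ) (p : Fin (n + 1) → S × Set.Ioi (0 : ℝ)), IsPercolativeChain ν n p ∧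
    x ∈ markedBall (p 0) ∧ y ∈ markedBall (p (Fin.last n))

/-- The percolation cluster of `x`. -/
def cluster (ν : Measure (S × Set.Ioi (0 : ℝ))) (x : S) : Set S := {y | Percolates ν x y}

/-- `M(x) = sup {d(x, y) | y in the cluster of x} ∈ [0, ∞]`, which is `0` for an empty cluster. -/
noncomputable def clusterRadius (ν : Measure (S × Set.Ioi (0 : ℝ))) (x : S) : ℝ≥0∞ :=
  ⨆ y ∈ cluster ν x, edist x y

end Percolation

end BooleanPercolation

/-! The model is dominated by subcritical site percolation on a net. Take a maximal `R₀`-separated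
set and partition `S` into cells, each inside the `R₀`-ball of its net point. Cells are occupied
independently, each with probability at most `lam * (C_V * R₀ ^ s)`, and doubling leaves at most `K`
net points within `8 * R₀` of any one. A cluster of radius above `6 * R₀ + n * (8 * R₀)` forces a
self-avoiding chain of `n` occupied cells (`exists_long_occupied_chain`). The union bound
`measure_exists_chain_le` gives this probability at most `(K * lam * C_V * R₀ ^ s) ^ n`, uniformly
in the starting point, which decays geometrically for small `lam`. -/

namespace BooleanPercolation

/-! ### Occupation probabilities of a Poisson process -/

section PointProcessBounds

variable {X Ω : Type*} [MeasurableSpace X] [MeasurableSpace Ω]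

/-- For finite `a` this is `1 - exp (-a) ≤ a`. -/
theorem poissonLaw_compl_zero_le (a : ℝ≥0∞) : poissonLaw a {0}ᶜ ≤ a := by
  unfold poissonLaw
  split_ifs with h
  · simp [h]
  · rw [Measure.map_apply (by fun_prop) (measurableSet_singleton 0).compl]
    have hpre : (fun n : ℕ => (n : ℝ≥0∞)) ⁻¹' {0}ᶜ = {0}ᶜ := by ext; simp
    rw [hpre, prob_compl_eq_one_sub (measurableSet_singleton 0), poissonMeasure_singleton]
    have h1 : (1 : ℝ≥0∞) = ENNReal.ofReal 1 := by simp
    rw [h1, ← ENNReal.ofReal_sub _ (by positivity)]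
    refine ENNReal.ofReal_le_of_le_toReal ?_
    have h2 := Real.add_one_le_exp (-(a.toNNReal : ℝ))
    have h3 : ((a.toNNReal : ℝ≥0) : ℝ) = a.toReal := rfl
    simp only [pow_zero, Nat.factorial_zero, Nat.cast_one, mul_one, div_one]
    linarith

theorem IsPoissonPointProcess.measurable_apply {ξ : Ω → Measure X} {m : Measure X} {P : Measure Ω}
    (h : IsPoissonPointProcess ξ m P) {A : Set X} (hA : MeasurableSet A) :
    Measurable fun ω => ξ ω A :=
  (Measure.measurable_coe hA).comp h.measurable

theorem IsPoissonPointProcess.measure_ne_zero_le {ξ : Ω → Measure X} {m : Measure X}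
    {P : Measure Ω} (h : IsPoissonPointProcess ξ m P) {A : Set X} (hA : MeasurableSet A) :
    P {ω | ξ ω A ≠ 0} ≤ m A := by
  have h1 := poissonLaw_compl_zero_le (m A)
  rwa [← h.poisson A hA, Measure.map_apply (h.measurable_apply hA)
    (measurableSet_singleton 0).compl] at h1

theorem IsPoissonPointProcess.measure_forall_ne_zero_le {ξ : Ω → Measure X} {m : Measure X}
    {P : Measure Ω} (h : IsPoissonPointProcess ξ m P) {ι : Type*} {A : ι → Set X}
    (hA : ∀ i, MeasurableSet (A i)) (hd : Pairwise fun i j => Disjoint (A i) (A j))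
    {p : ℝ≥0∞} (hp : ∀ i, m (A i) ≤ p) {l : List ι} (hl : l.Nodup) :
    P {ω | ∀ i ∈ l, ξ ω (A i) ≠ 0} ≤ p ^ l.length := by
  have hind := h.indep l.length (fun k => A l[k]) (fun k => hA _)
    (fun a b hab => hd fun e => hab (List.nodup_iff_injective_get.1 hl e))
  have hset : {ω | ∀ i ∈ l, ξ ω (A i) ≠ 0}
      = ⋂ k : Fin l.length, (fun ω => ξ ω (A l[k])) ⁻¹' {0}ᶜ := by
    ext ω
    simp [Fin.forall_iff, List.forall_mem_iff_getElem]
  rw [hset, hind.meas_iInter fun k => ⟨_, (measurableSet_singleton 0).compl, rfl⟩]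
  calc _ ≤ ∏ _k : Fin l.length, p := Finset.prod_le_prod' fun k _ =>
        (h.measure_ne_zero_le (hA _)).trans (hp _)
    _ = p ^ l.length := by simp

end PointProcessBounds

/-! ### Counting self-avoiding chains -/

section Chains

variable {ι : Type*}

/-- In a graph of degree at most `K`, at most `K ^ n` chains of length `n` issue from a vertex. -/
theorem exists_finset_chains [DecidableEq ι] (nbr : ι → Finset ι) {K : ℕ}
    (hK : ∀ i, (nbr i).card ≤ K) (n : ℕ) (i : ι) :
    ∃ T : Finset (List ι), T.card ≤ K ^ n ∧
      ∀ l : List ι, l.length = n → (i :: l).IsChain (fun a b => b ∈ nbr a) → l ∈ T := by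
  induction n generalizing i with
  | zero => exact ⟨{[]}, by simp, fun l hl _ => by simp_all⟩
  | succ n ih =>
    choose T hT hmem using ih
    refine ⟨(nbr i).biUnion fun j => (T j).image (List.cons j), ?_, ?_⟩
    · refine (Finset.card_biUnion_le_card_mul _ _ (K ^ n) fun j _ =>
        Finset.card_image_le.trans (hT j)).trans ?_
      rw [pow_succ']
      exact Nat.mul_le_mul_right _ (hK i)
    · rintro (_ | ⟨j, l⟩) hl hc
      · simp at hl
      · rw [List.isChain_cons_cons] at hc
        exact Finset.mem_biUnion.2 ⟨j, hc.1, Finset.mem_image_of_mem _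
          (hmem j l (by simpa using hl) hc.2)⟩

/-- Union bound over the at most `K ^ n` chains. The start `i` need not satisfy its own event, so it
can be fixed independently of `ω`. -/
theorem measure_exists_chain_le {Ω : Type*} [MeasurableSpace Ω] (P : Measure Ω)
    (nbr : ι → Finset ι) {K : ℕ} (hK : ∀ i, (nbr i).card ≤ K) (E : ι → Set Ω) {p : ℝ≥0∞}
    (hE : ∀ l : List ι, l.Nodup → P {ω | ∀ i ∈ l, ω ∈ E i} ≤ p ^ l.length) (n : ℕ) (i : ι) :
    P {ω | ∃ l : List ι, l.length = n ∧ l.Nodup ∧ (i :: l).IsChain (fun a b => b ∈ nbr a) ∧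
      ∀ j ∈ l, ω ∈ E j} ≤ (K * p) ^ n := by
  classical
  obtain ⟨T, hT, hmem⟩ := exists_finset_chains nbr hK n i
  calc _ ≤ P (⋃ l ∈ T.filter (fun l => l.length = n ∧ l.Nodup), {ω | ∀ j ∈ l, ω ∈ E j}) := by
        refine measure_mono ?_
        rintro ω ⟨l, hl, hnd, hc, hω⟩
        exact Set.mem_biUnion (Finset.mem_filter.2 ⟨hmem l hl hc, hl, hnd⟩) hω
    _ ≤ ∑ l ∈ T.filter (fun l => l.length = n ∧ l.Nodup), P {ω | ∀ j ∈ l, ω ∈ E j} :=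
        measure_biUnion_finset_le _ _
    _ ≤ ∑ _l ∈ T.filter (fun l => l.length = n ∧ l.Nodup), p ^ n :=
        Finset.sum_le_sum fun l hl => by
          obtain ⟨_, hlen, hnd⟩ := Finset.mem_filter.1 hl
          exact hlen ▸ hE l hnd
    _ ≤ (K : ℝ≥0∞) ^ n * p ^ n := by
        rw [Finset.sum_const, nsmul_eq_mul]
        gcongr
        exact_mod_cast (Finset.card_filter_le _ _).trans hT
    _ = (K * p) ^ n := (mul_pow _ _ _).symm

/-- Loop erasure: a walk in the graph of `r` contains a path. Symmetry is needed because
`SimpleGraph.fromRel` symmetrizes `r`. -/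
theorem exists_nodup_isChain_of_reflTransGen {r : ι → ι → Prop} (hr : ∀ a b, r a b → r b a) {i j : ι}
    (h : Relation.ReflTransGen r i j) :
    ∃ l : List ι, (i :: l).Nodup ∧ (i :: l).IsChain r ∧ (i :: l).getLast (by simp) = j := by
  classical
  let G : SimpleGraph ι := SimpleGraph.fromRel r
  have hreach : G.Reachable i j := by
    induction h with
    | refl => exact SimpleGraph.Reachable.refl _
    | @tail b c _ hbc ih =>
      by_cases hne : b = c
      · exact hne ▸ ih
      · exact ih.trans (SimpleGraph.Adj.reachable
          ((SimpleGraph.fromRel_adj _ _ _).2 ⟨hne, Or.inl hbc⟩))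
  obtain ⟨w, hw⟩ := hreach.exists_isPath
  have heq : i :: w.support.tail = w.support := w.cons_tail_support
  refine ⟨w.support.tail, heq ▸ hw.support_nodup, ?_, ?_⟩
  · rw [heq]
    refine w.isChain_adj_support.imp fun a b hab => ?_
    rcases ((SimpleGraph.fromRel_adj _ _ _).1 hab).2 with h | h
    exacts [h, hr _ _ h]
  · simp only [heq, SimpleGraph.Walk.getLast_support]

theorem dist_getLast_le_of_isChain {S : Type*} [PseudoMetricSpace S] {c : ι → S} {D : ℝ} (i : ι)
    (l : List ι) (hl : (i :: l).IsChain fun a b => dist (c a) (c b) < D) :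
    dist (c i) (c ((i :: l).getLast (by simp))) ≤ l.length * D := by
  induction l generalizing i with
  | nil => simp
  | cons j l ih =>
    rw [List.isChain_cons_cons] at hl
    have h1 := ih j hl.2
    rw [List.getLast_cons (by simp)]
    have h2 := dist_triangle (c i) (c j) (c ((j :: l).getLast (by simp)))
    have h3 := hl.1
    simp only [List.length_cons, Nat.cast_add, Nat.cast_one]
    linarith

end Chains

/-! ### Separated nets and cells -/

section Nets

variable {S : Type*} [MetricSpace S]

theorem exists_cover_ball_two_pow {N : ℕ}
    (hN : ∀ (x : S) (r : ℝ), 0 < r →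
      ∃ t : Finset S, t.card ≤ N ∧ Metric.ball x r ⊆ ⋃ y ∈ t, Metric.ball y (r / 2))
    (k : ℕ) (x : S) {r : ℝ} (hr : 0 < r) :
    ∃ t : Finset S, t.card ≤ N ^ k ∧ Metric.ball x (2 ^ k * r) ⊆ ⋃ y ∈ t, Metric.ball y r := by
  classical
  induction k generalizing x with
  | zero => exact ⟨{x}, by simp, by simp⟩
  | succ k ih =>
    obtain ⟨t, ht, hcov⟩ := hN x (2 ^ (k + 1) * r) (by positivity)
    choose u hu hucov using ih
    refine ⟨t.biUnion u, ?_, ?_⟩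
    · rw [pow_succ']
      exact (Finset.card_biUnion_le_card_mul _ _ _ fun y _ => hu y).trans
        (Nat.mul_le_mul_right _ ht)
    · intro z hz
      obtain ⟨y, hy, hzy⟩ := Set.mem_iUnion₂.1 (hcov hz)
      have he : (2 : ℝ) ^ (k + 1) * r / 2 = 2 ^ k * r := by ring
      rw [he] at hzy
      obtain ⟨w, hw, hzw⟩ := Set.mem_iUnion₂.1 (hucov y hzy)
      exact Set.mem_iUnion₂.2 ⟨w, Finset.mem_biUnion.2 ⟨y, hy, hw⟩, hzw⟩

/-- A separated net of a doubling space has locally boundedly many points. -/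
theorem exists_finset_net_ball (hS : IsDoubling S) {R : ℝ} (hR : 0 < R) {A : Set S}
    (hA : A.Pairwise fun a b => R ≤ dist a b) :
    ∃ (K : ℕ) (nbr : A → Finset A), (∀ i, (nbr i).card ≤ K) ∧
      ∀ i j : A, dist (i : S) j < 8 * R → j ∈ nbr i := by
  classical
  obtain ⟨N, hN⟩ := hS
  have key : ∀ i : A, ∃ T : Finset A, T.card ≤ N ^ 4 ∧
      ∀ j : A, dist (i : S) j < 8 * R → j ∈ T := by
    intro i
    -- Four halvings bring `8 * R` down to `R / 2`, where a ball holds at most one net point; `f`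
    -- picks it, with `i` as junk value for balls holding none.
    obtain ⟨t, ht, hcov⟩ := exists_cover_ball_two_pow hN 4 (i : S) (half_pos hR)
    let f : S → A := fun y => if h : ∃ j : A, dist (j : S) y < R / 2 then h.choose else i
    refine ⟨t.image f, Finset.card_image_le.trans ht, fun j hj => ?_⟩
    have hjb : (j : S) ∈ Metric.ball (i : S) (2 ^ 4 * (R / 2)) := by
      rw [Metric.mem_ball, dist_comm]; linarith
    obtain ⟨y, hy, hjy⟩ := Set.mem_iUnion₂.1 (hcov hjb)
    have hex : ∃ j : A, dist (j : S) y < R / 2 := ⟨j, hjy⟩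
    refine Finset.mem_image.2 ⟨y, hy, ?_⟩
    have hf : f y = hex.choose := dif_pos hex
    rw [hf]
    by_contra hne
    have h1 := hA hex.choose.2 j.2 (fun h => hne (Subtype.ext h))
    have h2 := hex.choose_spec
    have h3 := dist_triangle_right (hex.choose : S) j y
    rw [Metric.mem_ball] at hjy
    linarith
  choose nbr h1 h2 using key
  exact ⟨N ^ 4, nbr, h1, h2⟩

theorem exists_maximal_separated (R : ℝ) (hR : 0 < R) :
    ∃ A : Set S, A.Pairwise (fun a b => R ≤ dist a b) ∧ ∀ x, ∃ a ∈ A, dist x a < R := by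
  obtain ⟨A, hA⟩ := zorn_subset {A : Set S | A.Pairwise fun a b => R ≤ dist a b} (by
    intro C hC hchain
    refine ⟨⋃₀ C, ?_, fun s hs => Set.subset_sUnion_of_mem hs⟩
    exact (Set.pairwise_sUnion hchain.directedOn).2 fun s hs => hC hs)
  refine ⟨A, hA.prop, fun x => ?_⟩
  by_contra! h
  have hx : x ∈ A := hA.le_of_ge (y := insert x A) (by
    exact Set.pairwise_insert.2
      ⟨hA.prop, fun b hb _ => ⟨h b hb, by rw [dist_comm]; exact h b hb⟩⟩) (Set.subset_insert _ _) (Set.mem_insert _ _)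
  have := h x hx
  rw [dist_self] at this
  linarith

theorem countable_of_separated [TopologicalSpace.SeparableSpace S] {R : ℝ} (hR : 0 < R)
    {A : Set S} (hA : A.Pairwise fun a b => R ≤ dist a b) : A.Countable := by
  refine Set.PairwiseDisjoint.countable_of_isOpen (s := fun a => Metric.ball a (R / 2)) ?_
    (fun _ _ => Metric.isOpen_ball) (fun a _ => Metric.nonempty_ball.2 (half_pos hR))
  intro a ha b hb hab
  refine Metric.ball_disjoint_ball ?_
  linarith [hA ha hb hab]

/-- A countable family of measurable sets can be shrunk to a measurable partition of its union. -/
theorem exists_measurable_disjoint_refinement {X ι : Type*} [MeasurableSpace X] [Countable ι]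
    {B : ι → Set X} (hB : ∀ i, MeasurableSet (B i)) :
    ∃ Q : ι → Set X, (∀ i, MeasurableSet (Q i)) ∧ (∀ i, Q i ⊆ B i) ∧
      (Pairwise fun i j => Disjoint (Q i) (Q j)) ∧ ⋃ i, Q i = ⋃ i, B i := by
  obtain ⟨e, he⟩ := exists_injective_nat ι
  -- Each point goes to the first set containing it in the order given by `e`.
  refine ⟨fun i => B i \ ⋃ (j) (_ : e j < e i), B j, fun i => (hB i).diff
    (MeasurableSet.iUnion fun j => MeasurableSet.iUnion fun _ => hB j),
    fun i => Set.sdiff_subset, ?_, ?_⟩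
  · intro i j hij
    rw [Set.disjoint_left]
    rintro x ⟨hi, hi'⟩ ⟨hj, hj'⟩
    simp only [Set.mem_iUnion, not_exists] at hi' hj'
    rcases lt_or_gt_of_ne (he.ne hij) with h | h
    exacts [hj' i h hi, hi' j h hj]
  · refine (Set.iUnion_mono fun i => Set.sdiff_subset).antisymm fun x hx => ?_
    have hne : {i | x ∈ B i}.Nonempty := Set.mem_iUnion.1 hx
    let i := Function.argminOn e {i | x ∈ B i} hne
    refine Set.mem_iUnion.2 ⟨i, Function.argminOn_mem e _ hne, ?_⟩
    simp only [Set.mem_iUnion, not_exists]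
    exact fun j hj hxj => Function.not_lt_argminOn e _ hxj hj

end Nets

/-! ### From clusters to chains of occupied cells -/

section Clusters

variable {S : Type*} [MetricSpace S] [MeasurableSpace S]

/-- A point of the support is close to the centre of some occupied cell. -/
theorem exists_occupied_cell {ι : Type*} [Countable ι] {c : ι → S} {Q : ι → Set S} {R : ℝ}
    (hR : 0 < R) (hQ : ∀ i, Q i ⊆ Metric.ball (c i) R) (hcov : ⋃ i, Q i = Set.univ)
    {ν : Measure (S × Set.Ioi (0 : ℝ))} {p : S × Set.Ioi (0 : ℝ)} (hp : p ∈ ν.support) :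
    ∃ i, ν (Q i ×ˢ Set.univ) ≠ 0 ∧ dist (c i) p.1 < 2 * R := by
  by_contra! h
  have hpos := (Measure.mem_support_iff_forall p).1 hp (Metric.ball p.1 R ×ˢ Set.univ)
    (prod_mem_nhds (Metric.ball_mem_nhds _ hR) univ_mem)
  refine hpos.ne' (measure_mono_null (t := ⋃ i ∈ {i | ν (Q i ×ˢ Set.univ) = 0}, Q i ×ˢ Set.univ)
    ?_ ((measure_biUnion_null_iff (Set.to_countable _)).2 fun i hi => hi))
  rintro ⟨z, t⟩ ⟨hz, -⟩
  obtain ⟨i, hi⟩ := Set.mem_iUnion.1 (hcov ▸ Set.mem_univ z)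
  refine Set.mem_biUnion (x := i) ?_ ⟨hi, trivial⟩
  by_contra hne
  have h1 := h i hne
  have h2 := hQ i hi
  rw [Metric.mem_ball] at h2 hz
  have h3 := dist_triangle_left (c i) p.1 z
  change dist z p.1 < R at hz
  linarith

/-- Replace each point of the chain by an occupied cell centred within `2 * R`. Intersecting balls
have centres within `2 * R`, so consecutive cells are within `6 * R`; the bound `8 * R` leaves
slack. -/
theorem exists_occupied_chain {ι : Type*} [Countable ι] {c : ι → S} {Q : ι → Set S} {R : ℝ}
    (hR : 0 < R) (hQ : ∀ i, Q i ⊆ Metric.ball (c i) R) (hcov : ⋃ i, Q i = Set.univ)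
    {ν : Measure (S × Set.Ioi (0 : ℝ))} (hν : ∀ p ∈ ν.support, (p.2 : ℝ) = R) {x y : S}
    (hxy : Percolates ν x y) :
    ∃ i j, ν (Q i ×ˢ Set.univ) ≠ 0 ∧ dist x (c i) < 3 * R ∧ dist (c j) y < 3 * R ∧
      Relation.ReflTransGen (fun a b => ν (Q a ×ˢ Set.univ) ≠ 0 ∧ ν (Q b ×ˢ Set.univ) ≠ 0 ∧
        dist (c a) (c b) < 8 * R) i j := by
  obtain ⟨n, p, ⟨hsupp, hinter⟩, hx, hy⟩ := hxy
  choose f hf hfd using fun k => exists_occupied_cell hR hQ hcov (hsupp k)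
  have hball : ∀ k z, z ∈ markedBall (p k) → dist z (p k).1 < R := by
    intro k z hz
    rw [← hν _ (hsupp k)]
    exact hz
  refine ⟨f 0, f (Fin.last n), hf 0, ?_, ?_, ?_⟩
  · have h1 := hball _ _ hx
    have h2 := hfd 0
    have h3 := dist_triangle_right x (c (f 0)) (p 0).1
    linarith
  · have h1 := hball _ _ hy
    have h2 := hfd (Fin.last n)
    have h3 := dist_triangle_right (c (f (Fin.last n))) y (p (Fin.last n)).1
    linarith
  · refine Fin.induction (motive := fun k => Relation.ReflTransGen _ (f 0) (f k)) .refl ?_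
      (Fin.last n)
    intro k hk
    refine hk.tail ⟨hf _, hf _, ?_⟩
    obtain ⟨z, hz1, hz2⟩ := hinter k
    have h1 := hball _ _ hz1
    have h2 := hball _ _ hz2
    have h3 := hfd k.castSucc
    have h4 := hfd k.succ
    have h5 := dist_triangle_right (c (f k.castSucc)) z (p k.castSucc).1
    have h6 := dist_triangle_right (c (f k.succ)) z (p k.succ).1
    have h7 := dist_triangle_right (c (f k.castSucc)) (c (f k.succ)) z
    linarith

/-- A large cluster contains a long self-avoiding chain of occupied cells. -/
theorem exists_long_occupied_chain {ι : Type*} [Countable ι] {c : ι → S} {Q : ι → Set S} {R : ℝ}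
    (hR : 0 < R) (hQ : ∀ i, Q i ⊆ Metric.ball (c i) R) (hcov : ⋃ i, Q i = Set.univ)
    {ν : Measure (S × Set.Ioi (0 : ℝ))} (hν : ∀ p ∈ ν.support, (p.2 : ℝ) = R) {x : S} {u : ι}
    (hu : dist x (c u) < R) {n : ℕ} {r : ℝ} (hr : 6 * R + n * (8 * R) ≤ r)
    (hx : ENNReal.ofReal r < clusterRadius ν x) :
    ∃ l : List ι, l.length = n ∧ l.Nodup ∧
      (u :: l).IsChain (fun a b => dist (c a) (c b) < 8 * R) ∧
      ∀ j ∈ l, ν (Q j ×ˢ Set.univ) ≠ 0 := by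
  obtain ⟨y, hy⟩ := lt_iSup_iff.1 hx
  obtain ⟨hyc, hlt⟩ := lt_iSup_iff.1 hy
  obtain ⟨i, j, hi, hxi, hjy, hij⟩ := exists_occupied_chain hR hQ hcov hν hyc
  rw [edist_dist, ENNReal.ofReal_lt_ofReal_iff'] at hlt
  obtain ⟨l, hnd, hc, hlast⟩ := exists_nodup_isChain_of_reflTransGen
    (fun a b h => ⟨h.2.1, h.1, by rw [dist_comm]; exact h.2.2⟩) hij
  have hcd := hc.imp (S := fun a b => dist (c a) (c b) < 8 * R) fun a b h => h.2.2
  have hocc : ∀ k ∈ i :: l, ν (Q k ×ˢ Set.univ) ≠ 0 := by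
    have hall := hc.imp (S := fun a b => ν (Q a ×ˢ Set.univ) ≠ 0 → ν (Q b ×ˢ Set.univ) ≠ 0)
      fun a b h _ => h.2.1
    clear hnd hlast hcd hc hij hxi
    induction l generalizing i with
    | nil => simpa using hi
    | cons b l ih =>
      rw [List.isChain_cons_cons] at hall
      intro k hk
      rcases List.mem_cons.1 hk with rfl | hk
      exacts [hi, ih b (hall.1 hi) hall.2 k hk]
  have hlen : n ≤ l.length := by
    have h1 := dist_getLast_le_of_isChain (c := c) i l hcd
    rw [hlast] at h1
    have h2 := dist_triangle4 x (c i) (c j) y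
    have h3 : (n : ℝ) * (8 * R) < l.length * (8 * R) := by linarith [hlt.1]
    exact_mod_cast (lt_of_mul_lt_mul_right h3 (by positivity)).le
  -- The first occupied cell `i` depends on the configuration, so the chain is attached to `u`,
  -- which depends only on `x`.
  refine ⟨(i :: l).take n, by simp; omega, hnd.sublist (List.take_sublist _ _), ?_,
    fun k hk => hocc k (List.mem_of_mem_take hk)⟩
  have hstep : (u :: i :: l).IsChain (fun a b => dist (c a) (c b) < 8 * R) := by
    refine List.isChain_cons_cons.2 ⟨?_, hcd⟩
    have h1 := dist_triangle_left (c u) (c i) x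
    linarith
  simpa using hstep.take (n + 1)

end Clusters

end BooleanPercolation

theorem mainTheorem3 {S : Type*} [MetricSpace S] [MeasurableSpace S] [BorelSpace S]
    [LocallyCompactSpace S] [TopologicalSpace.SeparableSpace S]
    (hunbdd : ¬ Bornology.IsBounded (Set.univ : Set S))
    (hdoubling : BooleanPercolation.IsDoubling S)
    (hperfect : BooleanPercolation.IsUniformlyPerfect S)
    (μ : Measure S) (hinf : μ Set.univ = ∞) (hfin : BooleanPercolation.IsBoundedlyFinite μ)
    (C_V s : ℝ) (hC : 1 ≤ C_V) (hs : 0 < s)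
    (hvol : ∀ (x : S) (r : ℝ), 0 < r → μ (Metric.ball x r) ≤ ENNReal.ofReal (C_V * r ^ s))
    (R₀ : ℝ) (hR₀ : 0 < R₀) :
    ∃ lam₀ : ℝ, 0 < lam₀ ∧ ∀ lam : ℝ, 0 < lam → lam < lam₀ →
      ∀ {Ω : Type*} [MeasurableSpace Ω] (P : Measure Ω) [IsProbabilityMeasure P]
        (ξ : Ω → Measure (S × Set.Ioi (0 : ℝ))),
        BooleanPercolation.IsPoissonPointProcess ξ
          ((ENNReal.ofReal lam • μ).prod
            (Measure.dirac (⟨R₀, hR₀⟩ : Set.Ioi (0 : ℝ)))) P →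
        Tendsto
          (fun r : ℝ =>
            ⨆ x : S, P {ω | ENNReal.ofReal r < BooleanPercolation.clusterRadius (ξ ω) x})
          atTop (𝓝 0) := by
  obtain ⟨A, hsep, hdense⟩ := BooleanPercolation.exists_maximal_separated (S := S) R₀ hR₀
  have : Countable A := (BooleanPercolation.countable_of_separated hR₀ hsep).to_subtype
  obtain ⟨K, nbr, hK, hnbr⟩ := BooleanPercolation.exists_finset_net_ball hdoubling hR₀ hsep
  obtain ⟨Q, hQm, hQ, hQd, hQcov⟩ := BooleanPercolation.exists_measurable_disjoint_refinement
    (B := fun a : A => Metric.ball (a : S) R₀) fun a => Metric.isOpen_ball.measurableSet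
  replace hQcov : ⋃ a, Q a = Set.univ := by
    refine hQcov.trans (Set.eq_univ_of_forall fun x => ?_)
    obtain ⟨a, ha, hxa⟩ := hdense x
    exact Set.mem_iUnion.2 ⟨⟨a, ha⟩, hxa⟩
  have hV : 0 < C_V * R₀ ^ s := by positivity
  -- `K + 1` rather than `K` keeps the denominator positive when `K = 0`.
  refine ⟨1 / ((K + 1) * (C_V * R₀ ^ s)), by positivity, fun lam hlam hlt Ω _ P _ ξ hξ => ?_⟩
  have hvolQ : ∀ a, ((ENNReal.ofReal lam • μ).prod (Measure.dirac (⟨R₀, hR₀⟩ : Set.Ioi (0 : ℝ))))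
      (Q a ×ˢ Set.univ) ≤ ENNReal.ofReal (lam * (C_V * R₀ ^ s)) := by
    intro a
    rw [Measure.prod_prod, measure_univ, mul_one, Measure.smul_apply, smul_eq_mul,
      ENNReal.ofReal_mul hlam.le]
    gcongr
    exact (measure_mono (hQ a)).trans (hvol _ _ hR₀)
  have hsmall : (K : ℝ≥0∞) * ENNReal.ofReal (lam * (C_V * R₀ ^ s)) < 1 := by
    rw [← ENNReal.ofReal_natCast, ← ENNReal.ofReal_mul (by positivity), ENNReal.ofReal_lt_one]
    rw [lt_div_iff₀ (by positivity)] at hlt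
    have : 0 < lam * (C_V * R₀ ^ s) := by positivity
    linarith
  -- The marks different from `R₀` form an open region of zero intensity; almost surely it carries
  -- no mass, hence no support point.
  have hrad : ∀ᵐ ω ∂P, ∀ p ∈ (ξ ω).support, (p.2 : ℝ) = R₀ := by
    have hm : MeasurableSet ((Set.univ : Set S) ×ˢ ({⟨R₀, hR₀⟩}ᶜ : Set (Set.Ioi (0 : ℝ)))) :=
      MeasurableSet.univ.prod (measurableSet_singleton _).compl
    have hnull := hξ.measure_ne_zero_le hm
    rw [Measure.prod_prod, Measure.dirac_apply' _ (measurableSet_singleton _).compl] at hnull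
    simp only [Set.mem_compl_iff, Set.mem_singleton_iff, not_true_eq_false, not_false_eq_true,
      Set.indicator_of_notMem, mul_zero, nonpos_iff_eq_zero] at hnull
    filter_upwards [measure_eq_zero_iff_ae_notMem.1 hnull] with ω hω p hp
    by_contra hne
    have hmem : p.2 ∈ ({⟨R₀, hR₀⟩}ᶜ : Set (Set.Ioi (0 : ℝ))) :=
      fun h => hne (congrArg Subtype.val (Set.mem_singleton_iff.1 h))
    exact ((Measure.mem_support_iff_forall p).1 hp _ (prod_mem_nhds univ_mem
      (isOpen_compl_singleton.mem_nhds hmem))).ne' (not_not.1 hω)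
  rw [ENNReal.tendsto_nhds_zero]
  intro ε hε
  -- `n` is fixed before `r` and `x`, which makes the bound uniform in `x`.
  obtain ⟨n, hn⟩ := ((ENNReal.tendsto_nhds_zero.1
    (ENNReal.tendsto_pow_atTop_nhds_zero_of_lt_one hsmall)) ε hε).exists
  filter_upwards [eventually_ge_atTop (6 * R₀ + n * (8 * R₀))] with r hr
  refine iSup_le fun x => le_trans ?_ hn
  obtain ⟨a, ha, hxa⟩ := hdense x
  refine le_trans (measure_mono_ae ?_) (BooleanPercolation.measure_exists_chain_le P nbr hK
    (fun i => {ω | ξ ω (Q i ×ˢ Set.univ) ≠ 0}) (fun l hl => hξ.measure_forall_ne_zero_le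
      (fun i => (hQm i).prod MeasurableSet.univ)
      (fun i j hij => Set.disjoint_prod.2 (Or.inl (hQd hij))) hvolQ hl) n ⟨a, ha⟩)
  filter_upwards [hrad] with ω hω hM
  obtain ⟨l, h1, h2, h3, h4⟩ := BooleanPercolation.exists_long_occupied_chain
    (c := fun a : A => (a : S)) hR₀ hQ hQcov hω (u := ⟨a, ha⟩) hxa hr hM
  exact ⟨l, h1, h2, h3.imp fun i j h => hnbr i j h, h4⟩
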